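/- Let $\Theta\subseteq\mathbb R^m$ be open and let $f:\mathbb R^n\times\Theta\to\mathbb R$ be such that: - $f$ is $C^2$ on $\mathbb R^n\times\Theta$; - $\nabla_x f$ is $L$-Lipschitz in $(x,\theta)$, i.e. $\|\nabla_x f(x,\theta)-\nabla_x f(x',\theta')\|\le L\sqrt{\|x-x'\|^2+\|\theta-\theta'\|^2}$ for all $x,x'\in\mathbb R^n$, $\theta,\theta'\in\Theta$, where $L>0$; - for every $\theta\in\Theta$, all sublevel sets of $x\mapsto f(x,\theta)$ are bounded, and $x\mapsto f(x,\theta)$ is strongly convex (with a modulus that may depend on $\theta$). Let $(a_k)_{k\ge0},(b_k)_{k\ge0}$ be sequences in $[0,1]$ and $(\gamma_k)_{k\ge0}$ a sequence in $\,]0,2/L[$ such that, for some $\tau>0$, one of the following two conditions holds: - for all $k\ge1$: $a_k<\frac{\gamma_kL}{2}b_k$ and $\tau<(1+a_k)-\frac{\gamma_kL}{2}(1+b_k)^2$; - for all $k\ge1$: ($b_k\le a_k$ or $\frac{\gamma_kL}{2}b_k\le a_k<b_k$) and $\tau<(1-3a_k)-\frac{\gamma_kL}{2}(1-b_k)^2$.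 Suppose that $a_k\to a\in[0,1]$, $b_k\to b\in[0,1]$ and $\gamma_k\to\gamma\in\,]0,2/L[$, and that, if $a<1$ and $b<1$, then for every $\theta\in\Theta$ $$\frac{2(b-a)-1}{1+2b}<\underline\eta_\theta ,$$ where $\underline\eta_\theta$ is the smallest eigenvalue of $\mathrm{Id}-\gamma\nabla_x^2f(x^\star,\theta)$ and $x^\star$ is a minimizer of $f(\cdot,\theta)$. Let $X_0:\Theta\to\mathbb R^n\times\mathbb R^n$ be $C^1$ and let $X_{k+1}(\theta)=F_k(X_k(\theta),\theta)$ for $k\ge0$, where $$F_k(x,z,\theta)=\begin{pmatrix}x+a_k(x-z)-\gamma_k\nabla_xf(x+b_k(x-z),\theta)\\ x\end{pmatrix}.$$ Let $F$ be the map obtained from $F_k$ by replacing $a_k,b_k,\gamma_k$ with $a,b,\gamma$. Then for every $\theta\in\Theta$ the function $f(\cdot,\theta)$ has a unique minimizer $x^\star(\theta)$ and, with $X^\star(\theta)=(x^\star(\theta),x^\star(\theta))$, the following hold. 1. The functions $X_k$ and $X^\star$ are differentiable on $\Theta$, and for every $\theta\in\Theta$, $X_k(\theta)\to X^\star(\theta)$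 and $\partial_\theta X_k(\theta)\to\partial_\theta X^\star(\theta)$ as $k\to\infty$ (the sequence is derivative stable). 2. For every $\theta\in\Theta$, the matrix $\mathrm{Id}-J_1F(X^\star(\theta),\theta)$ is invertible and $\partial_\theta X^\star(\theta)=(\mathrm{Id}-J_1F(X^\star(\theta),\theta))^{-1}J_2F(X^\star(\theta),\theta)$, where $J_1F$ and $J_2F$ are the Jacobians of $F$ with respect to $(x,z)$ and to $\theta$; explicitly, $$\partial_\theta X^\star(\theta)=\begin{pmatrix}-a\,\mathrm{Id}+\gamma(1+b)\nabla_x^2f(x^\star(\theta),\theta)&a\,\mathrm{Id}-\gamma b\,\nabla_x^2f(x^\star(\theta),\theta)\\-\mathrm{Id}&\mathrm{Id}\end{pmatrix}^{-1}\begin{pmatrix}-\gamma\nabla_{x\theta}^2f(x^\star(\theta),\theta)\\0\end{pmatrix}.$$ -/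

import Mathlib

open Set Filter Topology

noncomputable section

namespace InertialMethod

variable {n m : ℕ}

/-- The partial gradient `∇ₓ f(x, θ)` of a parametric objective `f`. -/
def gradX (f : EuclideanSpace ℝ (Fin n) → EuclideanSpace ℝ (Fin m) → ℝ)
    (x : EuclideanSpace ℝ (Fin n)) (θ : EuclideanSpace ℝ (Fin m)) :
    EuclideanSpace ℝ (Fin n) :=
  gradient (fun u => f u θ) x

/-- The Hessian `∇²ₓ f(x, θ)`: the derivative in `x` of the partial gradient `∇ₓ f`. -/
def hessXX (f : EuclideanSpace ℝ (Fin n) → EuclideanSpace ℝ (Fin m) → ℝ)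
    (x : EuclideanSpace ℝ (Fin n)) (θ : EuclideanSpace ℝ (Fin m)) :
    EuclideanSpace ℝ (Fin n) →L[ℝ] EuclideanSpace ℝ (Fin n) :=
  fderiv ℝ (fun u => gradX f u θ) x

/-- The mixed second derivative `∇²ₓθ f(x, θ)`: the derivative in `θ` of the partial
gradient `∇ₓ f`. -/
def hessXT (f : EuclideanSpace ℝ (Fin n) → EuclideanSpace ℝ (Fin m) → ℝ)
    (x : EuclideanSpace ℝ (Fin n)) (θ : EuclideanSpace ℝ (Fin m)) :
    EuclideanSpace ℝ (Fin m) →L[ℝ] EuclideanSpace ℝ (Fin n) :=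
  fderiv ℝ (fun t => gradX f x t) θ

/-- One step of the inertial method on `ℝⁿ × ℝⁿ`, with inertial parameters `a`, `b` and
stepsize `γ`:
`F((x, z), θ) = (x + a (x - z) - γ ∇ₓ f(x + b (x - z), θ), x)`. -/
def stepMap (f : EuclideanSpace ℝ (Fin n) → EuclideanSpace ℝ (Fin m) → ℝ) (a b γ : ℝ)
    (X : EuclideanSpace ℝ (Fin n) × EuclideanSpace ℝ (Fin n))
    (θ : EuclideanSpace ℝ (Fin m)) :
    EuclideanSpace ℝ (Fin n) × EuclideanSpace ℝ (Fin n) :=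
  (X.1 + a • (X.1 - X.2) - γ • gradX f (X.1 + b • (X.1 - X.2)) θ, X.1)

/-- The iterates `X₀(θ)` and `X_{k+1}(θ) = F_k(X_k(θ), θ)`, where `F_k` is the step with
parameters `a k`, `b k`, `γ k`. -/
def iterate (f : EuclideanSpace ℝ (Fin n) → EuclideanSpace ℝ (Fin m) → ℝ)
    (a b γ : ℕ → ℝ)
    (X₀ : EuclideanSpace ℝ (Fin m) → EuclideanSpace ℝ (Fin n) × EuclideanSpace ℝ (Fin n)) :
    ℕ → EuclideanSpace ℝ (Fin m) → EuclideanSpace ℝ (Fin n) × EuclideanSpace ℝ (Fin n)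
  | 0, θ => X₀ θ
  | k + 1, θ => stepMap f (a k) (b k) (γ k) (iterate f a b γ X₀ k θ) θ

/-- The operator on `ℝⁿ × ℝⁿ` given by the block matrix `[[A, B], [C, D]]`. -/
def block (A B C D : EuclideanSpace ℝ (Fin n) →L[ℝ] EuclideanSpace ℝ (Fin n)) :
    (EuclideanSpace ℝ (Fin n) × EuclideanSpace ℝ (Fin n)) →L[ℝ]
      (EuclideanSpace ℝ (Fin n) × EuclideanSpace ℝ (Fin n)) :=
  (A.coprod B).prod (C.coprod D)

/-- The block matrix `[[-a Id + γ (1 + b) H, a Id - γ b H], [-Id, Id]]`. -/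
def limitBlock (a b γ : ℝ) (H : EuclideanSpace ℝ (Fin n) →L[ℝ] EuclideanSpace ℝ (Fin n)) :
    (EuclideanSpace ℝ (Fin n) × EuclideanSpace ℝ (Fin n)) →L[ℝ]
      (EuclideanSpace ℝ (Fin n) × EuclideanSpace ℝ (Fin n)) :=
  block
    (-(a • ContinuousLinearMap.id ℝ (EuclideanSpace ℝ (Fin n))) + (γ * (1 + b)) • H)
    (a • ContinuousLinearMap.id ℝ (EuclideanSpace ℝ (Fin n)) - (γ * b) • H)
    (-ContinuousLinearMap.id ℝ (EuclideanSpace ℝ (Fin n)))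
    (ContinuousLinearMap.id ℝ (EuclideanSpace ℝ (Fin n)))

/-- The sequence `X` of functions of `θ` is derivative stable on `Θ`, with limit `Xlim`:
all functions are differentiable on `Θ`, and there `X k → Xlim` and
`∂_θ (X k) → ∂_θ Xlim` pointwise. -/
structure DerivativeStable (Θ : Set (EuclideanSpace ℝ (Fin m)))
    (X : ℕ → EuclideanSpace ℝ (Fin m) →
      EuclideanSpace ℝ (Fin n) × EuclideanSpace ℝ (Fin n))
    (Xlim : EuclideanSpace ℝ (Fin m) →
      EuclideanSpace ℝ (Fin n) × EuclideanSpace ℝ (Fin n)) : Prop where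
  differentiable_iterate : ∀ k, ∀ θ ∈ Θ, DifferentiableAt ℝ (X k) θ
  differentiable_limit : ∀ θ ∈ Θ, DifferentiableAt ℝ Xlim θ
  tendsto : ∀ θ ∈ Θ, Tendsto (fun k => X k θ) atTop (𝓝 (Xlim θ))
  tendsto_fderiv : ∀ θ ∈ Θ,
    Tendsto (fun k => fderiv ℝ (X k) θ) atTop (𝓝 (fderiv ℝ Xlim θ))

end InertialMethod

end

namespace InertialMethod

theorem tendsto_zero_of_le_mul_add {s ε : ℕ → ℝ} {ρ : ℝ} (hρ0 : 0 ≤ ρ) (hρ : ρ < 1)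
    (hs : ∀ k, 0 ≤ s k) (hstep : ∀ᶠ k in atTop, s (k + 1) ≤ ρ * s k + ε k)
    (hε : Tendsto ε atTop (𝓝 0)) : Tendsto s atTop (𝓝 0) := by
  rw [Metric.tendsto_atTop]
  intro δ hδ
  have hpos : 0 < (1 - ρ) * (δ / 2) := mul_pos (by linarith) (by linarith)
  obtain ⟨N, hN⟩ := eventually_atTop.1 (hstep.and (hε.eventually (ge_mem_nhds hpos)))
  have key : ∀ j, s (N + j) ≤ δ / 2 + ρ ^ j * s N := by
    intro j
    induction j with
    | zero => simp; linarith
    | succ j ih =>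
      obtain ⟨h1, h2⟩ := hN (N + j) (by omega)
      have h3 := mul_le_mul_of_nonneg_left ih hρ0
      rw [← add_assoc, pow_succ]
      nlinarith
  have hlim : Tendsto (fun j => ρ ^ j * s N) atTop (𝓝 0) := by
    simpa using (tendsto_pow_atTop_nhds_zero_of_lt_one hρ0 hρ).mul_const (s N)
  obtain ⟨M, hM⟩ := eventually_atTop.1 (hlim.eventually (gt_mem_nhds (half_pos hδ)))
  refine ⟨N + M, fun k hk => ?_⟩
  obtain ⟨j, rfl⟩ := Nat.exists_eq_add_of_le (show N ≤ k by omega)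
  have h1 := hM j (by omega)
  have h2 := key j
  rw [Real.dist_eq, sub_zero, abs_of_nonneg (hs _)]
  linarith

section Lyapunov

variable {E : Type*} [NormedAddCommGroup E] [InnerProductSpace ℝ E]

/-- The Lyapunov weight of the squared increment. -/
noncomputable def incrementWeight (τ α β s : ℝ) : ℝ := α + s * β ^ 2 + |α - s * β| + τ / 2

/-- The Lyapunov function of the inertial method for two consecutive iterates `p`, `q`. -/
noncomputable def energy (τ α β s : ℝ) (p q : E) : ℝ :=
  ‖q‖ ^ 2 - α * ‖p‖ ^ 2 + incrementWeight τ α β s * ‖q - p‖ ^ 2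

theorem two_inner_le (x y : E) {t : ℝ} (ht : 0 < t) :
    2 * inner ℝ x y ≤ t * ‖x‖ ^ 2 + t⁻¹ * ‖y‖ ^ 2 := by
  have h := real_inner_le_norm x y
  have h2 : 0 ≤ t⁻¹ * (t * ‖x‖ - ‖y‖) ^ 2 := by positivity
  have h3 : t⁻¹ * (t * ‖x‖ - ‖y‖) ^ 2 = t * ‖x‖ ^ 2 + t⁻¹ * ‖y‖ ^ 2 - 2 * (‖x‖ * ‖y‖) := by
    field_simp
    ring
  linarith

theorem two_mul_inner_le_abs (x y : E) (κ : ℝ) :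
    2 * (κ * inner ℝ x y) ≤ |κ| * (‖x‖ ^ 2 + ‖y‖ ^ 2) := by
  have h1 : κ * inner ℝ x y ≤ |κ| * (‖x‖ * ‖y‖) :=
    calc κ * inner ℝ x y ≤ |κ * inner ℝ x y| := le_abs_self _
      _ = |κ| * |inner ℝ x y| := abs_mul _ _
      _ ≤ |κ| * (‖x‖ * ‖y‖) :=
        mul_le_mul_of_nonneg_left (abs_real_inner_le_norm x y) (abs_nonneg _)
  nlinarith [mul_nonneg (abs_nonneg κ) (sq_nonneg (‖x‖ - ‖y‖))]

/-- The forward term: a cocoercive and strongly monotone `g` at `y`, seen from another point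
`y + w`. -/
theorem neg_two_inner_add_le {y g w : E} {γ L μ ε : ℝ} (hγ : 0 < γ) (hL : 0 < L)
    (hε : 0 < ε) (hε2 : ε ≤ 1 / 2) (hcoc : ‖g‖ ^ 2 ≤ L * inner ℝ y g)
    (hmon : μ * ‖y‖ ^ 2 ≤ inner ℝ y g) :
    -(2 * γ * inner ℝ (y + w) g) ≤
      γ * L / 2 * (1 + 2 * ε) * ‖w‖ ^ 2 - 2 * γ * ε * μ * ‖y‖ ^ 2 := by
  have h1 : (1 - ε) * (‖g‖ ^ 2 / L) ≤ (1 - ε) * inner ℝ y g :=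
    mul_le_mul_of_nonneg_left ((div_le_iff₀' hL).2 hcoc) (by linarith)
  have h2 : ε * (μ * ‖y‖ ^ 2) ≤ ε * inner ℝ y g := mul_le_mul_of_nonneg_left hmon hε.le
  have hpos : 0 < 2 * (1 - ε) / L := div_pos (by linarith) hL
  have h3 := two_inner_le g (-w) hpos
  rw [inner_neg_right, norm_neg, real_inner_comm] at h3
  have h4 : (2 * (1 - ε) / L)⁻¹ ≤ L / 2 * (1 + 2 * ε) := by
    rw [inv_div, div_le_iff₀ (by linarith)]
    nlinarith [mul_nonneg hL.le (mul_nonneg hε.le (show 0 ≤ 1 - 2 * ε by linarith))]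
  have h5 := mul_le_mul_of_nonneg_right h4 (sq_nonneg ‖w‖)
  have h6 : -(2 * inner ℝ (y + w) g) ≤ L / 2 * (1 + 2 * ε) * ‖w‖ ^ 2 - 2 * ε * μ * ‖y‖ ^ 2 := by
    rw [inner_add_left]
    have : 2 * (1 - ε) / L * ‖g‖ ^ 2 = 2 * ((1 - ε) * (‖g‖ ^ 2 / L)) := by ring
    linarith
  have := mul_le_mul_of_nonneg_left h6 hγ.le
  linarith

theorem energy_step_le {p q g e : E} {τ α β γ L μ c : ℝ} (hγ : 0 < γ) (hL : 0 < L)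
    (hα : 0 ≤ α) (hβ : β ∈ Icc (0 : ℝ) 1) (hτ : 0 < τ)
    (hB : τ ≤ 1 - γ * L / 2 - α - γ * L / 2 * β ^ 2 - 2 * |α - γ * L / 2 * β|)
    (hc : 0 < c) (hcμ : c ≤ γ * μ * τ / 16) (hcτ : c ≤ τ / 8)
    (hcoc : ‖g‖ ^ 2 ≤ L * inner ℝ (q + β • (q - p)) g)
    (hmon : μ * ‖q + β • (q - p)‖ ^ 2 ≤ inner ℝ (q + β • (q - p)) g)
    {r : E} (hr : r = q + α • (q - p) - γ • g + e) :
    energy τ α β (γ * L / 2) q r ≤ energy τ α β (γ * L / 2) p q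
      - c / 4 * (‖q‖ ^ 2 + ‖q - p‖ ^ 2 + ‖r - q‖ ^ 2) + 5 / c * ‖e‖ ^ 2 := by
  obtain ⟨hβ0, hβ1⟩ := hβ
  set s := γ * L / 2 with hs
  have hs0 : 0 < s := by positivity
  set d := q - p with hd
  set d' := r - q with hd'
  set y := q + β • d with hy
  clear_value s d d' y
  have hκ := abs_nonneg (α - s * β)
  have hsβ : 0 ≤ s * β ^ 2 := by positivity
  have hs1 : s ≤ 1 := by linarith
  have hτ1 : τ ≤ 1 := by linarith
  -- expansion of `‖r‖²`
  have e1 : ‖r‖ ^ 2 = ‖q‖ ^ 2 + 2 * inner ℝ r d' - ‖d'‖ ^ 2 := by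
    have : q = r - d' := by simp [hd']
    rw [this, norm_sub_sq_real]; ring
  have e2 : d' = α • d - γ • g + e := by rw [hd', hr]; abel
  have e3 : inner ℝ r d' = α * inner ℝ r d - γ * inner ℝ r g + inner ℝ r e := by
    conv_lhs => rw [e2]
    simp [inner_add_right, inner_sub_right, inner_smul_right]
  have hrq : r = q + d' := by simp [hd']
  have e4 : 2 * inner ℝ q d = ‖q‖ ^ 2 - ‖p‖ ^ 2 + ‖d‖ ^ 2 := by
    have : p = q - d := by simp [hd]
    rw [this, norm_sub_sq_real]; ring
  have e5 : inner ℝ r d = inner ℝ q d + inner ℝ d' d := by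
    conv_lhs => rw [hrq]
    rw [inner_add_left]
  have e6 : inner ℝ r e = inner ℝ q e + inner ℝ d' e := by
    conv_lhs => rw [hrq]
    rw [inner_add_left]
  have hry : r = y + (d' - β • d) := by rw [hy, hrq]; abel
  have h1 := neg_two_inner_add_le (w := d' - β • d) (ε := τ / 32) hγ hL (by positivity)
    (by linarith) hcoc hmon
  rw [← hry, ← hs] at h1
  have e7 : ‖d' - β • d‖ ^ 2 = ‖d'‖ ^ 2 - 2 * β * inner ℝ d' d + β ^ 2 * ‖d‖ ^ 2 := by
    rw [norm_sub_sq_real, inner_smul_right, norm_smul, Real.norm_eq_abs, mul_pow, sq_abs]; ring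
  have hβ2 : β ^ 2 * ‖d‖ ^ 2 ≤ 1 * ‖d‖ ^ 2 :=
    mul_le_mul_of_nonneg_right (pow_le_one₀ hβ0 hβ1) (sq_nonneg _)
  have h2 : ‖d' - β • d‖ ^ 2 ≤ 2 * (‖d'‖ ^ 2 + ‖d‖ ^ 2) := by
    have := two_mul_inner_le_abs d' d (-β)
    rw [abs_neg, abs_of_nonneg hβ0] at this
    rw [e7]
    have h' : β * (‖d'‖ ^ 2 + ‖d‖ ^ 2) ≤ 1 * (‖d'‖ ^ 2 + ‖d‖ ^ 2) :=
      mul_le_mul_of_nonneg_right hβ1 (by positivity)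
    linarith [sq_nonneg ‖d'‖]
  have h3 : s * (2 * (τ / 32)) * ‖d' - β • d‖ ^ 2 ≤ τ / 8 * (‖d'‖ ^ 2 + ‖d‖ ^ 2) := by
    have : s * (2 * (τ / 32)) ≤ τ / 16 :=
      (mul_le_mul_of_nonneg_right hs1 (by positivity)).trans_eq (by ring)
    calc _ ≤ τ / 16 * (2 * (‖d'‖ ^ 2 + ‖d‖ ^ 2)) :=
          mul_le_mul this h2 (sq_nonneg _) (by positivity)
      _ = _ := by ring
  have h4 : ‖q‖ ^ 2 / 2 - ‖d‖ ^ 2 ≤ ‖y‖ ^ 2 := by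
    have e8 : ‖y‖ ^ 2 = ‖q‖ ^ 2 + 2 * (inner ℝ q (β • d)) + ‖β • d‖ ^ 2 := by
      rw [hy, norm_add_sq_real]
    have := two_inner_le q (-(β • d)) (show (0 : ℝ) < 1 / 2 by norm_num)
    rw [inner_neg_right, norm_neg] at this
    have e9 : ‖β • d‖ ^ 2 = β ^ 2 * ‖d‖ ^ 2 := by
      rw [norm_smul, Real.norm_eq_abs, mul_pow, sq_abs]
    rw [e8]
    norm_num at this
    linarith
  have h5 : c * (‖q‖ ^ 2 / 2 - ‖d‖ ^ 2) ≤ 2 * γ * (τ / 32) * μ * ‖y‖ ^ 2 :=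
    calc _ ≤ c * ‖y‖ ^ 2 := mul_le_mul_of_nonneg_left h4 hc.le
      _ ≤ (γ * μ * τ / 16) * ‖y‖ ^ 2 := mul_le_mul_of_nonneg_right hcμ (sq_nonneg _)
      _ = _ := by ring
  have h5' : c * ‖d‖ ^ 2 ≤ τ / 8 * ‖d‖ ^ 2 := mul_le_mul_of_nonneg_right hcτ (sq_nonneg _)
  have h6 := two_mul_inner_le_abs d' d (α - s * β)
  have h7 := two_inner_le q e (show 0 < c / 4 by positivity)
  have h8 := two_inner_le d' e (show 0 < τ / 8 by positivity)
  have h9 : ((c / 4)⁻¹ + (τ / 8)⁻¹) * ‖e‖ ^ 2 ≤ 5 / c * ‖e‖ ^ 2 := by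
    refine mul_le_mul_of_nonneg_right ?_ (sq_nonneg _)
    have : (τ / 8)⁻¹ ≤ c⁻¹ := inv_anti₀ hc hcτ
    have h : (c / 4)⁻¹ + c⁻¹ = 5 / c := by field_simp; norm_num
    linarith
  have h10 : c * (‖d‖ ^ 2 + ‖d'‖ ^ 2) ≤ τ / 8 * (‖d‖ ^ 2 + ‖d'‖ ^ 2) :=
    mul_le_mul_of_nonneg_right hcτ (by positivity)
  have h11 := mul_le_mul_of_nonneg_right hB (sq_nonneg ‖d'‖)
  have hτd := mul_nonneg hτ.le (sq_nonneg ‖d‖)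
  have hτd' := mul_nonneg hτ.le (sq_nonneg ‖d'‖)
  simp only [energy, incrementWeight]
  rw [← hd, ← hd', e1, e3, e5, e6]
  have e4' : α * (2 * inner ℝ q d) = α * (‖q‖ ^ 2 - ‖p‖ ^ 2 + ‖d‖ ^ 2) := by rw [e4]
  have e7' : s * ‖d' - β • d‖ ^ 2 =
    s * (‖d'‖ ^ 2 - 2 * β * inner ℝ d' d + β ^ 2 * ‖d‖ ^ 2) := by rw [e7]
  linarith

/-- An inertial recursion driven by uniformly cocoercive and strongly monotone terms `g k`,
with vanishing perturbations `e k`, converges to zero. -/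
theorem tendsto_zero_of_inertial_recursion {x g e : ℕ → E} {ak bk γk : ℕ → ℝ} {a b γ L μ τ : ℝ}
    (hγ : 0 < γ) (hL : 0 < L) (hμ : 0 < μ) (hτ : 0 < τ)
    (hγk : ∀ k, 0 < γk k) (hak : ∀ k, 0 ≤ ak k) (hbk : ∀ k, bk k ∈ Icc (0 : ℝ) 1)
    (hB : ∀ k, τ ≤ 1 - γk k * L / 2 - ak k - γk k * L / 2 * bk k ^ 2
      - 2 * |ak k - γk k * L / 2 * bk k|)
    (hak_lim : Tendsto ak atTop (𝓝 a)) (hbk_lim : Tendsto bk atTop (𝓝 b))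
    (hγk_lim : Tendsto γk atTop (𝓝 γ)) (he : Tendsto e atTop (𝓝 0))
    (hcoc : ∀ k, ‖g k‖ ^ 2 ≤ L * inner ℝ (x (k + 1) + bk k • (x (k + 1) - x k)) (g k))
    (hmon : ∀ k, μ * ‖x (k + 1) + bk k • (x (k + 1) - x k)‖ ^ 2 ≤
      inner ℝ (x (k + 1) + bk k • (x (k + 1) - x k)) (g k))
    (hstep : ∀ k, x (k + 2) = x (k + 1) + ak k • (x (k + 1) - x k) - γk k • g k + e k) :
    Tendsto x atTop (𝓝 0) := by
  set c : ℝ := min (γ * μ * τ / 32) (τ / 8) with hc_def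
  have hc : 0 < c := lt_min (by positivity) (by positivity)
  set V : ℕ → ℝ := fun k => energy τ (ak k) (bk k) (γk k * L / 2) (x k) (x (k + 1)) with hV
  set w : ℕ → ℝ := fun k => incrementWeight τ (ak k) (bk k) (γk k * L / 2) with hw
  have hs0 : ∀ k, 0 < γk k * L / 2 := fun k => by have := hγk k; positivity
  have hsb : ∀ k, 0 ≤ γk k * L / 2 * bk k ^ 2 := fun k => mul_nonneg (hs0 k).le (sq_nonneg _)
  have ha1 : ∀ k, ak k ≤ 1 - τ := fun k => by
    linarith [hB k, hs0 k, hsb k, abs_nonneg (ak k - γk k * L / 2 * bk k)]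
  have hτ1 : τ ≤ 1 := by linarith [ha1 0, hak 0]
  have hw0 : ∀ k, 0 ≤ w k := fun k => by
    have := hak k; have := hsb k; simp only [hw, incrementWeight]; positivity
  have hw1 : ∀ k, w k ≤ 1 := fun k => by
    simp only [hw, incrementWeight]
    linarith [hB k, hs0 k, hsb k, abs_nonneg (ak k - γk k * L / 2 * bk k)]
  have hc1 : c ≤ 1 := (min_le_right _ _).trans (by linarith)
  have hwlim : Tendsto w atTop (𝓝 (incrementWeight τ a b (γ * L / 2))) := by
    have hs := (hγk_lim.mul_const L).div_const 2
    exact (((hak_lim.add (hs.mul (hbk_lim.pow 2))).add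
      (hak_lim.sub (hs.mul hbk_lim)).abs).add_const _)
  have hdw : Tendsto (fun k => w (k + 1) - w k) atTop (𝓝 0) := by
    simpa using (hwlim.comp (tendsto_add_atTop_nat 1)).sub hwlim
  have hda : Tendsto (fun k => ak k - ak (k + 1)) atTop (𝓝 0) := by
    simpa using hak_lim.sub (hak_lim.comp (tendsto_add_atTop_nat 1))
  have hVle : ∀ k, V k ≤ ‖x (k + 1)‖ ^ 2 + ‖x (k + 1) - x k‖ ^ 2 := fun k => by
    have h1 : 0 ≤ ak k * ‖x k‖ ^ 2 := mul_nonneg (hak k) (sq_nonneg _)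
    have h2 := mul_le_mul_of_nonneg_right (hw1 k) (sq_nonneg ‖x (k + 1) - x k‖)
    simp only [hV, energy]
    linarith
  have hVstep : ∀ᶠ k in atTop,
      max (V (k + 1)) 0 ≤ (1 - c / 8) * max (V k) 0 + 5 / c * ‖e k‖ ^ 2 := by
    filter_upwards [hγk_lim.eventually (le_mem_nhds (half_lt_self hγ)),
      hdw.eventually (ge_mem_nhds (show 0 < c / 8 by positivity)),
      hda.eventually (ge_mem_nhds (show 0 < c / 8 by positivity))] with k hk1 hk2 hk3
    have h1 : V (k + 1) = energy τ (ak k) (bk k) (γk k * L / 2) (x (k + 1)) (x (k + 2))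
        + (ak k - ak (k + 1)) * ‖x (k + 1)‖ ^ 2
        + (w (k + 1) - w k) * ‖x (k + 2) - x (k + 1)‖ ^ 2 := by
      simp only [hV, energy, hw]; ring
    have h2 := energy_step_le (hγk k) hL (hak k) (hbk k) hτ (hB k) hc
      ((min_le_left _ _).trans (by
        have := mul_le_mul_of_nonneg_right hk1 (by positivity : 0 ≤ μ * τ / 16)
        linarith)) (min_le_right _ _) (hcoc k) (hmon k) (hstep k)
    have h3 := mul_le_mul_of_nonneg_right hk2 (sq_nonneg ‖x (k + 2) - x (k + 1)‖)
    have h4 := mul_le_mul_of_nonneg_right hk3 (sq_nonneg ‖x (k + 1)‖)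
    have h5 : V (k + 1) ≤ V k - c / 8 * (‖x (k + 1)‖ ^ 2 + ‖x (k + 1) - x k‖ ^ 2)
        + 5 / c * ‖e k‖ ^ 2 := by
      have : 0 ≤ c * ‖x (k + 1) - x k‖ ^ 2 := by positivity
      have : 0 ≤ c * ‖x (k + 2) - x (k + 1)‖ ^ 2 := by positivity
      rw [h1]
      change _ ≤ energy τ (ak k) (bk k) (γk k * L / 2) (x k) (x (k + 1)) - _ + _
      linarith
    have he0 : 0 ≤ 5 / c * ‖e k‖ ^ 2 := by positivity
    have hVp := le_max_left (V k) 0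
    have hp : 0 ≤ max (V k) 0 := le_max_right _ _
    have hρ : 0 ≤ (1 - c / 8) * max (V k) 0 := mul_nonneg (by linarith) hp
    refine max_le (h5.trans ?_) (by linarith)
    have h6 : max (V k) 0 ≤ ‖x (k + 1)‖ ^ 2 + ‖x (k + 1) - x k‖ ^ 2 :=
      max_le (hVle k) (by positivity)
    have h7 := mul_le_mul_of_nonneg_left h6 (show 0 ≤ c / 8 by positivity)
    linarith
  have hV0 : Tendsto (fun k => max (V k) 0) atTop (𝓝 0) :=
    tendsto_zero_of_le_mul_add (by linarith) (by linarith) (fun k => le_max_right _ _) hVstep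
      (by simpa using (he.norm.pow 2).const_mul (5 / c))
  have hx : Tendsto (fun k => ‖x k‖ ^ 2) atTop (𝓝 0) := by
    refine tendsto_zero_of_le_mul_add (by linarith : 0 ≤ 1 - τ) (by linarith)
      (fun k => sq_nonneg _) (Eventually.of_forall fun k => ?_) hV0
    have h1 := mul_le_mul_of_nonneg_right (ha1 k) (sq_nonneg ‖x k‖)
    have h2 := mul_nonneg (hw0 k) (sq_nonneg ‖x (k + 1) - x k‖)
    have h3 : V k ≤ _ := le_max_left (V k) 0
    have h4 : V k = ‖x (k + 1)‖ ^ 2 - ak k * ‖x k‖ ^ 2 + w k * ‖x (k + 1) - x k‖ ^ 2 := rfl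
    linarith
  rw [tendsto_zero_iff_norm_tendsto_zero]
  simpa using hx.sqrt

end Lyapunov

section Convex

variable {E : Type*} [NormedAddCommGroup E] [InnerProductSpace ℝ E] [CompleteSpace E]

theorem hasDerivAt_comp_segment {h : E → ℝ} {G : E → E} (hG : ∀ z, HasGradientAt h (G z) z)
    (x d : E) (t : ℝ) :
    HasDerivAt (fun t : ℝ => h (x + t • d)) (inner ℝ (G (x + t • d)) d) t := by
  have h1 : HasDerivAt (fun t : ℝ => x + t • d) d t := by
    simpa using ((hasDerivAt_id t).smul_const d).const_add x
  have h2 := (hG (x + t • d)).hasFDerivAt.comp_hasDerivAt t h1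
  rwa [InnerProductSpace.toDual_apply_apply] at h2

theorem add_inner_gradient_le {h : E → ℝ} {G : E → E} (hG : ∀ z, HasGradientAt h (G z) z)
    (hh : ConvexOn ℝ univ h) (x y : E) : h x + inner ℝ (G x) (y - x) ≤ h y := by
  have h1 : ConvexOn ℝ univ (fun t : ℝ => h (x + t • (y - x))) := by
    refine (hh.comp_affineMap (AffineMap.lineMap (k := ℝ) x y)).congr fun t _ => ?_
    simp [AffineMap.lineMap_apply, add_comm]
  have h2 := h1.le_slope_of_hasDerivAt (mem_univ 0) (mem_univ 1) zero_lt_one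
    (hasDerivAt_comp_segment hG x (y - x) 0)
  simp [slope_def_field] at h2
  linarith

/-- The descent lemma. -/
theorem le_add_inner_gradient {h : E → ℝ} {G : E → E} {L : ℝ}
    (hG : ∀ z, HasGradientAt h (G z) z) (hL : ∀ x y, ‖G x - G y‖ ≤ L * ‖x - y‖) (x d : E) :
    h (x + d) ≤ h x + inner ℝ (G x) d + L / 2 * ‖d‖ ^ 2 := by
  have hder : ∀ t : ℝ, HasDerivAt (fun t : ℝ => h (x + t • d) - t * inner ℝ (G x) d
      - L / 2 * ‖d‖ ^ 2 * t ^ 2)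
      (inner ℝ (G (x + t • d)) d - inner ℝ (G x) d - L * ‖d‖ ^ 2 * t) t := by
    intro t
    have h1 := (hasDerivAt_comp_segment hG x d t).sub
      ((hasDerivAt_id t).mul_const (inner ℝ (G x) d))
    have h2 := h1.sub ((hasDerivAt_pow 2 t).const_mul (L / 2 * ‖d‖ ^ 2))
    refine HasDerivAt.congr_deriv (f := fun t : ℝ => h (x + t • d) - t * inner ℝ (G x) d
      - L / 2 * ‖d‖ ^ 2 * t ^ 2) h2 ?_
    push_cast
    ring
  have hanti : AntitoneOn (fun t : ℝ => h (x + t • d) - t * inner ℝ (G x) d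
      - L / 2 * ‖d‖ ^ 2 * t ^ 2) (Ici 0) := by
    refine antitoneOn_of_deriv_nonpos (convex_Ici 0)
      (fun t _ => (hder t).continuousAt.continuousWithinAt)
      (fun t _ => (hder t).differentiableAt.differentiableWithinAt) fun t ht => ?_
    rw [interior_Ici, mem_Ioi] at ht
    rw [(hder t).deriv, ← inner_sub_left]
    have h1 := real_inner_le_norm (G (x + t • d) - G x) d
    have h2 := hL (x + t • d) x
    rw [add_sub_cancel_left, norm_smul, Real.norm_of_nonneg ht.le] at h2
    have h3 := mul_le_mul_of_nonneg_right h2 (norm_nonneg d)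
    linarith
  have := hanti (mem_Ici.2 le_rfl) (mem_Ici.2 zero_le_one) zero_le_one
  simp at this
  linarith

/-- The Baillon–Haddad theorem: a Lipschitz gradient of a convex function is cocoercive. -/
theorem norm_gradient_sub_sq_le {h : E → ℝ} {G : E → E} {L : ℝ} (hL0 : 0 < L)
    (hG : ∀ z, HasGradientAt h (G z) z) (hh : ConvexOn ℝ univ h)
    (hL : ∀ x y, ‖G x - G y‖ ≤ L * ‖x - y‖) (x y : E) :
    ‖G x - G y‖ ^ 2 ≤ L * inner ℝ (x - y) (G x - G y) := by
  have key : ∀ x y, h x + inner ℝ (G x) (y - x) + (2 * L)⁻¹ * ‖G x - G y‖ ^ 2 ≤ h y := by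
    intro x y
    set d : E := L⁻¹ • (G x - G y) with hd
    have h1 := add_inner_gradient_le hG hh x (y + d)
    have h2 := le_add_inner_gradient hG hL y d
    have h3 : inner ℝ (G x) (y + d - x) = inner ℝ (G x) (y - x) + inner ℝ (G x) d := by
      rw [← inner_add_right]; congr 1; abel
    have h4 : inner ℝ (G x) d - inner ℝ (G y) d = L⁻¹ * ‖G x - G y‖ ^ 2 := by
      rw [← inner_sub_left, hd, inner_smul_right, real_inner_self_eq_norm_sq]
    have h5 : L / 2 * ‖d‖ ^ 2 = (2 * L)⁻¹ * ‖G x - G y‖ ^ 2 := by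
      rw [hd, norm_smul, Real.norm_of_nonneg (inv_nonneg.2 hL0.le)]
      field_simp
    have h6 : L⁻¹ * ‖G x - G y‖ ^ 2 = 2 * ((2 * L)⁻¹ * ‖G x - G y‖ ^ 2) := by
      field_simp
    linarith
  have h1 := key x y
  have h2 := key y x
  rw [norm_sub_rev (G y)] at h2
  have h3 : inner ℝ (x - y) (G x - G y) = -inner ℝ (G x) (y - x) - inner ℝ (G y) (x - y) := by
    rw [real_inner_comm, inner_sub_left, ← neg_sub x y, inner_neg_right]
    ring
  have h4 : ‖G x - G y‖ ^ 2 = L * (2 * ((2 * L)⁻¹ * ‖G x - G y‖ ^ 2)) := by field_simp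
  rw [h4]
  exact mul_le_mul_of_nonneg_left (by linarith) hL0.le

theorem mul_norm_sub_sq_le_of_strongConvexOn {h : E → ℝ} {G : E → E} {μ : ℝ}
    (hG : ∀ z, HasGradientAt h (G z) z) (hh : StrongConvexOn univ μ h) (x y : E) :
    μ * ‖x - y‖ ^ 2 ≤ inner ℝ (x - y) (G x - G y) := by
  have hG' : ∀ z, HasGradientAt (fun z => h z - μ / 2 * ‖z‖ ^ 2) (G z - μ • z) z := by
    intro z
    rw [hasGradientAt_iff_hasFDerivAt]
    have h1 := (hG z).hasFDerivAt.sub (((hasStrictFDerivAt_norm_sq z).hasFDerivAt).const_mul (μ / 2))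
    refine HasFDerivAt.congr_fderiv (f := fun z => h z - μ / 2 * ‖z‖ ^ 2) h1 ?_
    ext v
    simp
    ring
  have h0 := strongConvexOn_iff_convex.1 hh
  have h1 := add_inner_gradient_le hG' h0 x y
  have h2 := add_inner_gradient_le hG' h0 y x
  have h3 : inner ℝ (G x - μ • x) (y - x) + inner ℝ (G y - μ • y) (x - y) =
      μ * ‖x - y‖ ^ 2 - inner ℝ (x - y) (G x - G y) := by
    rw [← neg_sub x y, inner_neg_right, neg_add_eq_sub, ← inner_sub_left,
      ← real_inner_self_eq_norm_sq, real_inner_comm (G x - G y), ← real_inner_smul_left,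
      ← inner_sub_left]
    congr 1
    rw [smul_sub]
    abel
  linarith

end Convex

section Linearization

variable {E : Type*} [NormedAddCommGroup E] [InnerProductSpace ℝ E]

theorem le_inner_fderiv_of_strongMonotone {G : E → E} {H : E →L[ℝ] E} {μ : ℝ} {x : E}
    (hH : HasFDerivAt G H x) (hG : ∀ y, μ * ‖y - x‖ ^ 2 ≤ inner ℝ (y - x) (G y - G x)) (v : E) :
    μ * ‖v‖ ^ 2 ≤ inner ℝ v (H v) := by
  have h2 := (hH.hasLineDerivAt v).tendsto_slope_zero_right
  refine le_of_tendsto_of_tendsto tendsto_const_nhds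
    ((continuous_const.inner continuous_id).continuousAt.tendsto.comp h2 :
      Tendsto (fun t : ℝ => inner ℝ v (t⁻¹ • (G (x + t • v) - G x))) _ _) ?_
  filter_upwards [self_mem_nhdsWithin] with t ht
  have ht : 0 < t := ht
  have h3 := hG (x + t • v)
  rw [add_sub_cancel_left, norm_smul, Real.norm_of_nonneg ht.le, real_inner_smul_left] at h3
  change _ ≤ inner ℝ v (t⁻¹ • (G (x + t • v) - G x))
  rw [inner_smul_right, ← div_eq_inv_mul, le_div_iff₀ ht]
  nlinarith

theorem norm_fderiv_sq_le_of_cocoercive {G : E → E} {H : E →L[ℝ] E} {L : ℝ} {x : E}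
    (hH : HasFDerivAt G H x) (hG : ∀ y, ‖G y - G x‖ ^ 2 ≤ L * inner ℝ (y - x) (G y - G x))
    (v : E) : ‖H v‖ ^ 2 ≤ L * inner ℝ v (H v) := by
  have h2 := (hH.hasLineDerivAt v).tendsto_slope_zero_right
  refine le_of_tendsto_of_tendsto (h2.norm.pow 2)
    (((continuous_const.inner continuous_id).continuousAt.tendsto.comp h2 :
      Tendsto (fun t : ℝ => inner ℝ v (t⁻¹ • (G (x + t • v) - G x))) _ _).const_mul L) ?_
  filter_upwards [self_mem_nhdsWithin] with t ht
  have ht : 0 < t := ht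
  have h3 := hG (x + t • v)
  rw [add_sub_cancel_left, real_inner_smul_left] at h3
  change _ ≤ L * inner ℝ v (t⁻¹ • (G (x + t • v) - G x))
  rw [inner_smul_right, norm_smul, norm_inv, Real.norm_of_nonneg ht.le, mul_pow]
  calc t⁻¹ ^ 2 * ‖G (x + t • v) - G x‖ ^ 2
      ≤ t⁻¹ ^ 2 * (L * (t * inner ℝ v (G (x + t • v) - G x))) :=
        mul_le_mul_of_nonneg_left h3 (by positivity)
    _ = _ := by field_simp

end Linearization

theorem dissipation_of_alternatives {a b s τ : ℝ} (hb : 0 ≤ b) (hs : s ≤ 1)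
    (h : (a < s * b ∧ τ < (1 + a) - s * (1 + b) ^ 2) ∨
      ((b ≤ a ∨ (s * b ≤ a ∧ a < b)) ∧ τ < (1 - 3 * a) - s * (1 - b) ^ 2)) :
    τ ≤ 1 - s - a - s * b ^ 2 - 2 * |a - s * b| := by
  rcases h with ⟨h1, h2⟩ | ⟨h1, h2⟩
  · rw [abs_of_neg (by linarith)]
    linarith
  · have : s * b ≤ a := by
      rcases h1 with h1 | h1
      · exact (mul_le_of_le_one_left hb hs).trans h1
      · exact h1.1
    rw [abs_of_nonneg (by linarith)]
    linarith

section Implicit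

variable {E P : Type*} [NormedAddCommGroup E] [NormedSpace ℝ E]
  [NormedAddCommGroup P] [NormedSpace ℝ P]

/-- A Lipschitz selection of zeros of `G(·, θ)` is differentiable where the partial derivative
of `G` is invertible. -/
theorem hasFDerivAt_of_implicit {G : E × P → E} {G' : E × P →L[ℝ] E} {ψ : P → E} {θ : P}
    {A : E ≃L[ℝ] E} {C : ℝ} (hG : HasFDerivAt G G' (ψ θ, θ))
    (hA : (A : E →L[ℝ] E) = G' ∘L ContinuousLinearMap.inl ℝ E P)
    (hψ : ∀ᶠ t in 𝓝 θ, ‖ψ t - ψ θ‖ ≤ C * ‖t - θ‖)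
    (hzero : ∀ᶠ t in 𝓝 θ, G (ψ t, t) = 0) :
    HasFDerivAt ψ (-((A.symm : E →L[ℝ] E) ∘L G' ∘L ContinuousLinearMap.inr ℝ E P)) θ := by
  have hO : (fun t => ψ t - ψ θ) =O[𝓝 θ] fun t => t - θ := Asymptotics.IsBigO.of_bound C hψ
  have hO2 : (fun t => (ψ t, t) - (ψ θ, θ)) =O[𝓝 θ] fun t => t - θ :=
    hO.prod_left (Asymptotics.isBigO_refl _ _)
  have hcont : Tendsto (fun t => (ψ t, t)) (𝓝 θ) (𝓝 (ψ θ, θ)) := by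
    have h0 : Tendsto (fun t => t - θ) (𝓝 θ) (𝓝 0) := by
      rw [tendsto_sub_nhds_zero_iff]
      exact tendsto_id
    have h1 : Tendsto ψ (𝓝 θ) (𝓝 (ψ θ)) := tendsto_sub_nhds_zero_iff.1 (hO.trans_tendsto h0)
    exact h1.prodMk_nhds tendsto_id
  have h1 := (hG.isLittleO.comp_tendsto hcont).trans_isBigO hO2
  have h2 := ((-(A.symm : E →L[ℝ] E)).isBigO_comp _ (𝓝 θ)).trans_isLittleO h1
  refine HasFDerivAt.of_isLittleO (h2.congr' ?_ EventuallyEq.rfl)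
  have hθ := hzero.self_of_nhds
  filter_upwards [hzero] with t ht
  have h3 : G' ((ψ t, t) - (ψ θ, θ)) = A (ψ t - ψ θ) + G' (0, t - θ) := by
    have : A (ψ t - ψ θ) = G' (ψ t - ψ θ, 0) := by
      change (A : E →L[ℝ] E) _ = _
      rw [hA]; rfl
    rw [this, ← map_add]
    simp
  change -A.symm (G (ψ t, t) - G (ψ θ, θ) - G' ((ψ t, t) - (ψ θ, θ))) = _
  rw [ht, hθ, h3]
  simp

theorem exists_equiv_of_injective [FiniteDimensional ℝ E] (A : E →L[ℝ] E)
    (hA : Function.Injective A) : ∃ B : E ≃L[ℝ] E, (B : E →L[ℝ] E) = A :=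
  ⟨(LinearEquiv.ofInjectiveEndo (A : E →ₗ[ℝ] E) hA).toContinuousLinearEquiv, by ext; rfl⟩

end Implicit

variable {n m : ℕ} {Θ : Set (EuclideanSpace ℝ (Fin m))}
  {f : EuclideanSpace ℝ (Fin n) → EuclideanSpace ℝ (Fin m) → ℝ} {θ : EuclideanSpace ℝ (Fin m)}

local notation "𝔼" => EuclideanSpace ℝ (Fin n)
local notation "ℙ" => EuclideanSpace ℝ (Fin m)

section Smoothness

theorem contDiffAt_objective (hΘ : IsOpen Θ)
    (hf : ContDiffOn ℝ 2 (fun p : 𝔼 × ℙ => f p.1 p.2) (univ ×ˢ Θ)) (hθ : θ ∈ Θ) (x : 𝔼) :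
    ContDiffAt ℝ 2 (fun p : 𝔼 × ℙ => f p.1 p.2) (x, θ) :=
  hf.contDiffAt ((isOpen_univ.prod hΘ).mem_nhds ⟨mem_univ _, hθ⟩)

theorem hasFDerivAt_slice (hΘ : IsOpen Θ)
    (hf : ContDiffOn ℝ 2 (fun p : 𝔼 × ℙ => f p.1 p.2) (univ ×ˢ Θ)) (hθ : θ ∈ Θ) (x : 𝔼) :
    HasFDerivAt (fun u => f u θ)
      (fderiv ℝ (fun p : 𝔼 × ℙ => f p.1 p.2) (x, θ) ∘L ContinuousLinearMap.inl ℝ 𝔼 ℙ) x := by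
  have h1 := ((contDiffAt_objective hΘ hf hθ x).differentiableAt (by norm_num)).hasFDerivAt
  exact HasFDerivAt.comp (g := fun p : 𝔼 × ℙ => f p.1 p.2) (f := fun u => (u, θ)) x h1 (hasFDerivAt_prodMk_left x θ)

theorem hasGradientAt_gradX (hΘ : IsOpen Θ)
    (hf : ContDiffOn ℝ 2 (fun p : 𝔼 × ℙ => f p.1 p.2) (univ ×ˢ Θ)) (hθ : θ ∈ Θ) (x : 𝔼) :
    HasGradientAt (fun u => f u θ) (gradX f x θ) x :=
  (hasFDerivAt_slice hΘ hf hθ x).differentiableAt.hasGradientAt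

theorem contDiffAt_gradX (hΘ : IsOpen Θ)
    (hf : ContDiffOn ℝ 2 (fun p : 𝔼 × ℙ => f p.1 p.2) (univ ×ˢ Θ)) (hθ : θ ∈ Θ) (x : 𝔼) :
    ContDiffAt ℝ 1 (fun p : 𝔼 × ℙ => gradX f p.1 p.2) (x, θ) := by
  have h1 : ContDiffAt ℝ 1 (fderiv ℝ (fun p : 𝔼 × ℙ => f p.1 p.2)) (x, θ) :=
    (contDiffAt_objective hΘ hf hθ x).fderiv_right (by norm_num)
  have h2 : ContDiffAt ℝ 1 (fun p : 𝔼 × ℙ => (InnerProductSpace.toDual ℝ 𝔼).symm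
      (fderiv ℝ (fun p : 𝔼 × ℙ => f p.1 p.2) p ∘L ContinuousLinearMap.inl ℝ 𝔼 ℙ)) (x, θ) :=
    (InnerProductSpace.toDual ℝ 𝔼).symm.contDiff.contDiffAt.comp _
      (h1.clm_comp contDiffAt_const)
  refine h2.congr_of_eventuallyEq ?_
  filter_upwards [(isOpen_univ.prod hΘ).mem_nhds ⟨mem_univ x, hθ⟩] with p hp
  rw [gradX, gradient, (hasFDerivAt_slice hΘ hf hp.2 p.1).fderiv]

theorem hasFDerivAt_gradX (hΘ : IsOpen Θ)
    (hf : ContDiffOn ℝ 2 (fun p : 𝔼 × ℙ => f p.1 p.2) (univ ×ˢ Θ)) (hθ : θ ∈ Θ) (x : 𝔼) :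
    HasFDerivAt (fun p : 𝔼 × ℙ => gradX f p.1 p.2)
      ((hessXX f x θ).coprod (hessXT f x θ)) (x, θ) := by
  have h := ((contDiffAt_gradX hΘ hf hθ x).differentiableAt one_ne_zero).hasFDerivAt
  have h1 : hessXX f x θ = _ :=
    (HasFDerivAt.comp (g := fun p : 𝔼 × ℙ => gradX f p.1 p.2) (f := fun u => (u, θ)) x h
      (hasFDerivAt_prodMk_left x θ)).fderiv
  have h2 : hessXT f x θ = _ :=
    (HasFDerivAt.comp (g := fun p : 𝔼 × ℙ => gradX f p.1 p.2) (f := fun t => (x, t)) θ h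
      (hasFDerivAt_prodMk_right x θ)).fderiv
  rw [h1, h2]
  refine h.congr_fderiv ?_
  ext v <;> simp

theorem hasFDerivAt_gradX_left (hΘ : IsOpen Θ)
    (hf : ContDiffOn ℝ 2 (fun p : 𝔼 × ℙ => f p.1 p.2) (univ ×ˢ Θ)) (hθ : θ ∈ Θ) (x : 𝔼) :
    HasFDerivAt (fun u => gradX f u θ) (hessXX f x θ) x := by
  have h := HasFDerivAt.comp (g := fun p : 𝔼 × ℙ => gradX f p.1 p.2) (f := fun u => (u, θ)) x
    (hasFDerivAt_gradX hΘ hf hθ x) (hasFDerivAt_prodMk_left x θ)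
  exact h.differentiableAt.hasFDerivAt

theorem tendsto_hess (hΘ : IsOpen Θ)
    (hf : ContDiffOn ℝ 2 (fun p : 𝔼 × ℙ => f p.1 p.2) (univ ×ˢ Θ)) (hθ : θ ∈ Θ) {x : 𝔼}
    {y : ℕ → 𝔼} (hy : Tendsto y atTop (𝓝 x)) (u : 𝔼) (v : ℙ) :
    Tendsto (fun k => hessXX f (y k) θ u + hessXT f (y k) θ v) atTop
      (𝓝 (hessXX f x θ u + hessXT f x θ v)) := by
  have h1 : ContinuousAt (fderiv ℝ (fun p : 𝔼 × ℙ => gradX f p.1 p.2)) (x, θ) :=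
    ((contDiffAt_gradX hΘ hf hθ x).fderiv_right (m := 0) (by norm_num)).continuousAt
  have h2 := (h1.clm_apply (continuousAt_const (y := (u, v)))).tendsto.comp
    (hy.prodMk_nhds (tendsto_const_nhds (x := θ)))
  simpa [Function.comp_def, (hasFDerivAt_gradX hΘ hf hθ _).fderiv] using h2

end Smoothness

section Step

theorem hasFDerivAt_stepMap (hΘ : IsOpen Θ)
    (hf : ContDiffOn ℝ 2 (fun p : 𝔼 × ℙ => f p.1 p.2) (univ ×ˢ Θ)) (hθ : θ ∈ Θ)
    (a b γ : ℝ) {X : ℙ → 𝔼 × 𝔼} {D : ℙ →L[ℝ] 𝔼 × 𝔼} (hX : HasFDerivAt X D θ) :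
    HasFDerivAt (fun t => stepMap f a b γ (X t) t)
      (((ContinuousLinearMap.fst ℝ 𝔼 𝔼 ∘L D
          + a • (ContinuousLinearMap.fst ℝ 𝔼 𝔼 ∘L D - ContinuousLinearMap.snd ℝ 𝔼 𝔼 ∘L D))
        - γ • (hessXX f ((X θ).1 + b • ((X θ).1 - (X θ).2)) θ ∘L
            (ContinuousLinearMap.fst ℝ 𝔼 𝔼 ∘L D
              + b • (ContinuousLinearMap.fst ℝ 𝔼 𝔼 ∘L D - ContinuousLinearMap.snd ℝ 𝔼 𝔼 ∘L D))
          + hessXT f ((X θ).1 + b • ((X θ).1 - (X θ).2)) θ)).prod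
        (ContinuousLinearMap.fst ℝ 𝔼 𝔼 ∘L D)) θ := by
  have h1 : HasFDerivAt (fun t => (X t).1) (ContinuousLinearMap.fst ℝ 𝔼 𝔼 ∘L D) θ := hX.fst
  have h2 : HasFDerivAt (fun t => (X t).2) (ContinuousLinearMap.snd ℝ 𝔼 𝔼 ∘L D) θ := hX.snd
  have hy := h1.add ((h1.sub h2).const_smul b)
  have hg := HasFDerivAt.comp (g := fun p : 𝔼 × ℙ => gradX f p.1 p.2)
    (f := fun t => ((X t).1 + b • ((X t).1 - (X t).2), t)) θ
    (hasFDerivAt_gradX hΘ hf hθ _) (hy.prodMk (hasFDerivAt_id θ))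
  have h3 := ((h1.add ((h1.sub h2).const_smul a)).sub (hg.const_smul γ)).prodMk h1
  refine HasFDerivAt.congr_fderiv (f := fun t => stepMap f a b γ (X t) t) h3 ?_
  ext v <;> simp

theorem fderiv_stepMap_left (hΘ : IsOpen Θ)
    (hf : ContDiffOn ℝ 2 (fun p : 𝔼 × ℙ => f p.1 p.2) (univ ×ˢ Θ)) (hθ : θ ∈ Θ)
    (a b γ : ℝ) (x : 𝔼) :
    ContinuousLinearMap.id ℝ (𝔼 × 𝔼) - fderiv ℝ (fun X => stepMap f a b γ X θ) (x, x) =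
      limitBlock a b γ (hessXX f x θ) := by
  have h1 : HasFDerivAt (fun X : 𝔼 × 𝔼 => X.1) (ContinuousLinearMap.fst ℝ 𝔼 𝔼) (x, x) :=
    hasFDerivAt_fst
  have h2 : HasFDerivAt (fun X : 𝔼 × 𝔼 => X.2) (ContinuousLinearMap.snd ℝ 𝔼 𝔼) (x, x) :=
    hasFDerivAt_snd
  have hy := h1.add ((h1.sub h2).const_smul b)
  have hg := HasFDerivAt.comp (g := fun u => gradX f u θ) (x, x)
    (hasFDerivAt_gradX_left hΘ hf hθ _) hy
  have h3 := ((h1.add ((h1.sub h2).const_smul a)).sub (hg.const_smul γ)).prodMk h1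
  have h4 : fderiv ℝ (fun X => stepMap f a b γ X θ) (x, x) = _ := h3.fderiv
  have hx : x + b • (x - x) = x := by simp
  rw [h4]
  simp only [Pi.add_apply, Pi.smul_apply, Pi.sub_apply, hx]
  refine ContinuousLinearMap.ext fun p => ?_
  obtain ⟨p, q⟩ := p
  simp [limitBlock, block]
  constructor
  · module
  · abel

theorem fderiv_stepMap_right (hΘ : IsOpen Θ)
    (hf : ContDiffOn ℝ 2 (fun p : 𝔼 × ℙ => f p.1 p.2) (univ ×ˢ Θ)) (hθ : θ ∈ Θ)
    (a b γ : ℝ) (x : 𝔼) :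
    fderiv ℝ (fun t => stepMap f a b γ (x, x) t) θ = (-(γ • hessXT f x θ)).prod 0 := by
  have h := (hasFDerivAt_stepMap hΘ hf hθ a b γ (hasFDerivAt_const (x, x) θ)).fderiv
  rw [h]
  ext v <;> simp

theorem limitBlock_apply_diag (a b γ : ℝ) (H : 𝔼 →L[ℝ] 𝔼) (x : 𝔼) :
    limitBlock a b γ H (x, x) = (γ • H x, 0) := by
  simp [limitBlock, block]
  module

theorem isInvertible_limitBlock (a b : ℝ) {γ : ℝ} (hγ : γ ≠ 0) {H : 𝔼 →L[ℝ] 𝔼}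
    (hH : Function.Injective H) : (limitBlock a b γ H).IsInvertible := by
  refine exists_equiv_of_injective _ ((injective_iff_map_eq_zero _).2 fun p hp => ?_)
  obtain ⟨x, z⟩ := p
  have h1 : z = x := by
    have := congrArg Prod.snd hp
    simp [limitBlock, block] at this
    exact (neg_add_eq_zero.1 this).symm
  subst h1
  rw [limitBlock_apply_diag] at hp
  have h2 : H z = 0 := (smul_eq_zero.1 (congrArg Prod.fst hp)).resolve_left hγ
  have h3 : z = 0 := hH (by rw [h2, map_zero])
  simp [h3]

end Step

theorem tendsto_clm_of_apply {ι E F : Type*} [NormedAddCommGroup E] [NormedSpace ℝ E]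
    [FiniteDimensional ℝ E] [NormedAddCommGroup F] [NormedSpace ℝ F] {l : Filter ι}
    {T : ι → E →L[ℝ] F} {S : E →L[ℝ] F} (h : ∀ v, Tendsto (fun i => T i v) l (𝓝 (S v))) :
    Tendsto T l (𝓝 S) := by
  let e : (E →L[ℝ] F) ≃L[ℝ] Fin (Module.finrank ℝ E) → F :=
    ((ContinuousLinearEquiv.ofFinrankEq
      (Module.finrank_fin_fun (n := Module.finrank ℝ E) ℝ).symm).arrowCongr
      (1 : F ≃L[ℝ] F)).trans (ContinuousLinearEquiv.piRing _)
  rw [e.toHomeomorph.isInducing.tendsto_nhds_iff]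
  exact tendsto_pi_nhds.2 fun i => h _

section Minimizer

theorem exists_minimizer (hΘ : IsOpen Θ)
    (hf : ContDiffOn ℝ 2 (fun p : 𝔼 × ℙ => f p.1 p.2) (univ ×ˢ Θ)) (hθ : θ ∈ Θ)
    (hlev : ∀ c : ℝ, Bornology.IsBounded {x | f x θ ≤ c}) : ∃ x, ∀ y, f x θ ≤ f y θ := by
  have hcont : Continuous (fun x => f x θ) := continuous_iff_continuousAt.2 fun x =>
    (hasFDerivAt_slice hΘ hf hθ x).continuousAt
  have hcomp : IsCompact {x | f x θ ≤ f 0 θ} :=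
    Metric.isCompact_of_isClosed_isBounded (isClosed_le hcont continuous_const) (hlev _)
  obtain ⟨x, hx, hmin⟩ := hcomp.exists_isMinOn ⟨0, le_refl (f 0 θ)⟩ hcont.continuousOn
  refine ⟨x, fun y => ?_⟩
  rcases le_total (f y θ) (f 0 θ) with hy | hy
  · exact hmin hy
  · exact le_trans hx hy

theorem gradX_eq_zero_of_minimizer {x : 𝔼} (hx : ∀ y, f x θ ≤ f y θ) : gradX f x θ = 0 := by
  have h : IsLocalMin (fun u => f u θ) x := Eventually.of_forall hx
  rw [gradX, gradient, h.fderiv_eq_zero, map_zero]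

theorem lt_of_minimizer {μ : ℝ} (hμ : 0 < μ) (hconv : StrongConvexOn univ μ (fun x => f x θ))
    {x y : 𝔼} (hx : ∀ y, f x θ ≤ f y θ) (hy : y ≠ x) : f x θ < f y θ := by
  refine lt_of_le_of_ne (hx y) fun h => hy ?_
  exact (hconv.strictConvexOn hμ).eq_of_isMinOn (f := fun x => f x θ)
    (fun z _ => h.symm.trans_le (hx z)) (fun z _ => hx z) (mem_univ _) (mem_univ _)

/-- The minimizers are pointwise Lipschitz in the parameter. -/
theorem norm_minimizer_sub_le {μ L : ℝ} (hμ : 0 < μ) {t : ℙ} {x x' : 𝔼}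
    (hmon : ∀ x y, μ * ‖x - y‖ ^ 2 ≤ inner ℝ (x - y) (gradX f x θ - gradX f y θ))
    (hL : ‖gradX f x' θ - gradX f x' t‖ ≤ L * ‖t - θ‖)
    (hx : gradX f x θ = 0) (hx' : gradX f x' t = 0) : ‖x' - x‖ ≤ L / μ * ‖t - θ‖ := by
  have h1 := hmon x' x
  rw [hx' , sub_zero] at hL
  rw [hx, sub_zero] at h1
  have h2 := real_inner_le_norm (x' - x) (gradX f x' θ)
  rw [div_mul_eq_mul_div, le_div_iff₀ hμ]
  rcases (norm_nonneg (x' - x)).eq_or_lt with h0 | h0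
  · rw [← h0]
    linarith [norm_nonneg (gradX f x' θ)]
  · refine le_of_mul_le_mul_left ?_ h0
    have := mul_le_mul_of_nonneg_left hL h0.le
    linarith

end Minimizer

section Iterates

theorem differentiableAt_iterate {ak bk γk : ℕ → ℝ} {X₀ : ℙ → 𝔼 × 𝔼} (hΘ : IsOpen Θ)
    (hf : ContDiffOn ℝ 2 (fun p : 𝔼 × ℙ => f p.1 p.2) (univ ×ˢ Θ)) (hθ : θ ∈ Θ)
    (hX₀ : ContDiffOn ℝ 1 X₀ Θ) (k : ℕ) : DifferentiableAt ℝ (iterate f ak bk γk X₀ k) θ := by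
  induction k with
  | zero => exact (hX₀.contDiffAt (hΘ.mem_nhds hθ)).differentiableAt one_ne_zero
  | succ k ih => exact (hasFDerivAt_stepMap hΘ hf hθ _ _ _ ih.hasFDerivAt).differentiableAt

theorem tendsto_iterate {ak bk γk : ℕ → ℝ} {X₀ : ℙ → 𝔼 × 𝔼}
    {a b γ L μ τ : ℝ} {x : 𝔼}
    (hL : 0 < L) (hμ : 0 < μ) (hτ : 0 < τ) (hγ : 0 < γ)
    (hγk : ∀ k, 0 < γk k) (hak : ∀ k, 0 ≤ ak k) (hbk : ∀ k, bk k ∈ Icc (0 : ℝ) 1)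
    (hB : ∀ k, 1 ≤ k → τ ≤ 1 - γk k * L / 2 - ak k - γk k * L / 2 * bk k ^ 2
      - 2 * |ak k - γk k * L / 2 * bk k|)
    (hak_lim : Tendsto ak atTop (𝓝 a)) (hbk_lim : Tendsto bk atTop (𝓝 b))
    (hγk_lim : Tendsto γk atTop (𝓝 γ))
    (hcoc : ∀ x y, ‖gradX f x θ - gradX f y θ‖ ^ 2 ≤
      L * inner ℝ (x - y) (gradX f x θ - gradX f y θ))
    (hmon : ∀ x y, μ * ‖x - y‖ ^ 2 ≤ inner ℝ (x - y) (gradX f x θ - gradX f y θ))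
    (hx : gradX f x θ = 0) :
    Tendsto (fun k => iterate f ak bk γk X₀ k θ) atTop (𝓝 (x, x)) := by
  set u : ℕ → 𝔼 := fun k => (iterate f ak bk γk X₀ k θ).1 with hu
  have hy : ∀ k, (u (k + 1) - x) + bk (k + 1) • ((u (k + 1) - x) - (u k - x)) =
      (u (k + 1) + bk (k + 1) • (u (k + 1) - u k)) - x := fun k => by module
  have h1 : Tendsto (fun k => u k - x) atTop (𝓝 0) := by
    refine tendsto_zero_of_inertial_recursion (e := fun _ => 0)
      (ak := fun k => ak (k + 1)) (bk := fun k => bk (k + 1)) (γk := fun k => γk (k + 1))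
      (g := fun k => gradX f (u (k + 1) + bk (k + 1) • (u (k + 1) - u k)) θ)
      hγ hL hμ hτ (fun k => hγk _) (fun k => hak _) (fun k => hbk _) (fun k => hB _ (by omega))
      (hak_lim.comp (tendsto_add_atTop_nat 1)) (hbk_lim.comp (tendsto_add_atTop_nat 1))
      (hγk_lim.comp (tendsto_add_atTop_nat 1)) tendsto_const_nhds
      (fun k => ?_) (fun k => ?_) (fun k => ?_)
    · rw [hy]
      simpa [hx] using hcoc (u (k + 1) + bk (k + 1) • (u (k + 1) - u k)) x
    · rw [hy]
      simpa [hx] using hmon (u (k + 1) + bk (k + 1) • (u (k + 1) - u k)) x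
    · have : u (k + 2) = u (k + 1) + ak (k + 1) • (u (k + 1) - u k)
        - γk (k + 1) • gradX f (u (k + 1) + bk (k + 1) • (u (k + 1) - u k)) θ := rfl
      rw [this]
      module
  have h2 : Tendsto u atTop (𝓝 x) := tendsto_sub_nhds_zero_iff.1 h1
  refine h2.prodMk_nhds ?_
  rw [← tendsto_add_atTop_iff_nat 1]
  exact h2

theorem tendsto_fderiv_iterate {ak bk γk : ℕ → ℝ} {X₀ : ℙ → 𝔼 × 𝔼}
    {a b γ L μ τ : ℝ} {x : 𝔼} (hΘ : IsOpen Θ)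
    (hf : ContDiffOn ℝ 2 (fun p : 𝔼 × ℙ => f p.1 p.2) (univ ×ˢ Θ)) (hθ : θ ∈ Θ)
    (hX₀ : ContDiffOn ℝ 1 X₀ Θ)
    (hL : 0 < L) (hμ : 0 < μ) (hτ : 0 < τ) (hγ : 0 < γ)
    (hγk : ∀ k, 0 < γk k) (hak : ∀ k, 0 ≤ ak k) (hbk : ∀ k, bk k ∈ Icc (0 : ℝ) 1)
    (hB : ∀ k, 1 ≤ k → τ ≤ 1 - γk k * L / 2 - ak k - γk k * L / 2 * bk k ^ 2
      - 2 * |ak k - γk k * L / 2 * bk k|)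
    (hak_lim : Tendsto ak atTop (𝓝 a)) (hbk_lim : Tendsto bk atTop (𝓝 b))
    (hγk_lim : Tendsto γk atTop (𝓝 γ))
    (hcoc : ∀ x v, ‖hessXX f x θ v‖ ^ 2 ≤ L * inner ℝ v (hessXX f x θ v))
    (hmon : ∀ x v, μ * ‖v‖ ^ 2 ≤ inner ℝ v (hessXX f x θ v))
    (hX : Tendsto (fun k => iterate f ak bk γk X₀ k θ) atTop (𝓝 (x, x)))
    {D : ℙ →L[ℝ] 𝔼} (hD : ∀ v, hessXX f x θ (D v) + hessXT f x θ v = 0) :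
    Tendsto (fun k => fderiv ℝ (iterate f ak bk γk X₀ k) θ) atTop (𝓝 (D.prod D)) := by
  suffices h : ∀ v, Tendsto (fun k => fderiv ℝ (iterate f ak bk γk X₀ k) θ v) atTop
      (𝓝 (D v, D v)) from tendsto_clm_of_apply h
  intro v
  have hfd := fun k => (hasFDerivAt_stepMap hΘ hf hθ (ak k) (bk k) (γk k)
    (differentiableAt_iterate (ak := ak) (bk := bk) (γk := γk) hΘ hf hθ hX₀ k).hasFDerivAt).fderiv
  set u : ℕ → 𝔼 := fun k => (iterate f ak bk γk X₀ k θ).1 with hu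
  have hu_lim : Tendsto u atTop (𝓝 x) := (continuous_fst.tendsto _).comp hX
  set y : ℕ → 𝔼 := fun k => u (k + 1) + bk (k + 1) • (u (k + 1) - u k) with hy
  have hy_lim : Tendsto y atTop (𝓝 x) := by
    have h1 := hu_lim.comp (tendsto_add_atTop_nat 1)
    simpa using h1.add ((hbk_lim.comp (tendsto_add_atTop_nat 1)).smul (h1.sub hu_lim))
  set d : ℕ → 𝔼 := fun k => (fderiv ℝ (iterate f ak bk γk X₀ k) θ v).1 with hd
  have hd2 : ∀ k, (fderiv ℝ (iterate f ak bk γk X₀ (k + 1)) θ v).2 = d k := fun k => by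
    have := congrArg (fun T : ℙ →L[ℝ] 𝔼 × 𝔼 => (T v).2) (hfd k)
    exact this
  have hd1 : ∀ k, d (k + 2) = d (k + 1) + ak (k + 1) • (d (k + 1) - d k) -
      γk (k + 1) • (hessXX f (y k) θ (d (k + 1) + bk (k + 1) • (d (k + 1) - d k))
        + hessXT f (y k) θ v) := fun k => by
    have := congrArg (fun T : ℙ →L[ℝ] 𝔼 × 𝔼 => (T v).1) (hfd (k + 1))
    rw [← hd2 k]
    exact this
  have h1 : Tendsto (fun k => d k - D v) atTop (𝓝 0) := by
    refine tendsto_zero_of_inertial_recursion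
      (e := fun k => -(γk (k + 1) • (hessXX f (y k) θ (D v) + hessXT f (y k) θ v)))
      (ak := fun k => ak (k + 1)) (bk := fun k => bk (k + 1)) (γk := fun k => γk (k + 1))
      (g := fun k => hessXX f (y k) θ
        ((d (k + 1) - D v) + bk (k + 1) • ((d (k + 1) - D v) - (d k - D v))))
      hγ hL hμ hτ (fun k => hγk _) (fun k => hak _) (fun k => hbk _) (fun k => hB _ (by omega))
      (hak_lim.comp (tendsto_add_atTop_nat 1)) (hbk_lim.comp (tendsto_add_atTop_nat 1))
      (hγk_lim.comp (tendsto_add_atTop_nat 1)) ?_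
      (fun k => hcoc _ _) (fun k => hmon _ _) (fun k => ?_)
    · have := ((hγk_lim.comp (tendsto_add_atTop_nat 1)).smul
        (tendsto_hess hΘ hf hθ hy_lim (D v) v)).neg
      simpa [hD v] using this
    · rw [hd1 k]
      have : d (k + 1) + bk (k + 1) • (d (k + 1) - d k) =
        ((d (k + 1) - D v) + bk (k + 1) • ((d (k + 1) - D v) - (d k - D v))) + D v := by module
      rw [this, map_add]
      module
  have h2 : Tendsto d atTop (𝓝 (D v)) := tendsto_sub_nhds_zero_iff.1 h1
  refine h2.prodMk_nhds ?_
  rw [← tendsto_add_atTop_iff_nat 1]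
  exact h2.congr fun k => (hd2 k).symm

end Iterates

end InertialMethod

theorem theorem3p1 {n m : ℕ} (Θ : Set (EuclideanSpace ℝ (Fin m))) (hΘ : IsOpen Θ)
    (f : EuclideanSpace ℝ (Fin n) → EuclideanSpace ℝ (Fin m) → ℝ) (L : ℝ)
    -- the objective: smoothness, Lipschitz partial gradient, level-boundedness
    (hf : ContDiffOn ℝ 2
      (fun p : EuclideanSpace ℝ (Fin n) × EuclideanSpace ℝ (Fin m) => f p.1 p.2)
      (univ ×ˢ Θ))
    (hL : ∀ x x' : EuclideanSpace ℝ (Fin n), ∀ θ ∈ Θ, ∀ θ' ∈ Θ,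
      ‖InertialMethod.gradX f x θ - InertialMethod.gradX f x' θ'‖ ≤
        L * √(‖x - x'‖ ^ 2 + ‖θ - θ'‖ ^ 2))
    (hlev : ∀ θ ∈ Θ, ∀ c : ℝ, Bornology.IsBounded {x | f x θ ≤ c})
    -- strong convexity in `x`, with a modulus that may depend on `θ`
    (hconv : ∀ θ ∈ Θ, ∃ μ : ℝ, 0 < μ ∧ StrongConvexOn univ μ (fun x => f x θ))
    -- the parameters of the method
    (ak bk γk : ℕ → ℝ)
    (hak : ∀ k, ak k ∈ Icc (0 : ℝ) 1) (hbk : ∀ k, bk k ∈ Icc (0 : ℝ) 1)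
    (hγk : ∀ k, γk k ∈ Ioo (0 : ℝ) (2 / L))
    (hB : ∃ τ : ℝ, 0 < τ ∧
      ((∀ k, 1 ≤ k → ak k < γk k * L / 2 * bk k ∧
          τ < (1 + ak k) - γk k * L / 2 * (1 + bk k) ^ 2) ∨
       (∀ k, 1 ≤ k → (bk k ≤ ak k ∨ (γk k * L / 2 * bk k ≤ ak k ∧ ak k < bk k)) ∧
          τ < (1 - 3 * ak k) - γk k * L / 2 * (1 - bk k) ^ 2)))
    (a b γ : ℝ) (ha : a ∈ Icc (0 : ℝ) 1) (hb : b ∈ Icc (0 : ℝ) 1)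
    (hγ : γ ∈ Ioo (0 : ℝ) (2 / L))
    (hak_lim : Tendsto ak atTop (𝓝 a)) (hbk_lim : Tendsto bk atTop (𝓝 b))
    (hγk_lim : Tendsto γk atTop (𝓝 γ))
    -- the smallest eigenvalue of `Id - γ ∇²ₓ f(x⋆(θ), θ)`
    (hC : a < 1 → b < 1 → ∀ θ ∈ Θ, ∀ x : EuclideanSpace ℝ (Fin n),
      (∀ y, f x θ ≤ f y θ) → ∀ η : ℝ,
      IsLeast {η' : ℝ | Module.End.HasEigenvalue
        ((ContinuousLinearMap.id ℝ (EuclideanSpace ℝ (Fin n)) -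
          γ • InertialMethod.hessXX f x θ :
            EuclideanSpace ℝ (Fin n) →L[ℝ] EuclideanSpace ℝ (Fin n)) :
          EuclideanSpace ℝ (Fin n) →ₗ[ℝ] EuclideanSpace ℝ (Fin n)) η'} η →
      (2 * (b - a) - 1) / (1 + 2 * b) < η)
    (X₀ : EuclideanSpace ℝ (Fin m) → EuclideanSpace ℝ (Fin n) × EuclideanSpace ℝ (Fin n))
    (hX₀ : ContDiffOn ℝ 1 X₀ Θ) :
    ∃ xs : EuclideanSpace ℝ (Fin m) → EuclideanSpace ℝ (Fin n),
      -- `xs θ` is the unique minimizer of `f(·, θ)`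
      (∀ θ ∈ Θ, ∀ y, y ≠ xs θ → f (xs θ) θ < f y θ) ∧
      -- the derivatives of the iterates converge to that of `X⋆ = (x⋆, x⋆)`
      InertialMethod.DerivativeStable Θ (InertialMethod.iterate f ak bk γk X₀)
        (fun θ => (xs θ, xs θ)) ∧
      ∀ θ ∈ Θ,
        -- the block matrix is `Id - J₁F(X⋆(θ), θ)` for the limit map `F`
        ContinuousLinearMap.id ℝ (EuclideanSpace ℝ (Fin n) × EuclideanSpace ℝ (Fin n)) -
            fderiv ℝ (fun X => InertialMethod.stepMap f a b γ X θ) (xs θ, xs θ) =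
          InertialMethod.limitBlock a b γ (InertialMethod.hessXX f (xs θ) θ) ∧
        -- the block column is `J₂F(X⋆(θ), θ)`
        fderiv ℝ (fun t => InertialMethod.stepMap f a b γ (xs θ, xs θ) t) θ =
          (-(γ • InertialMethod.hessXT f (xs θ) θ)).prod 0 ∧
        -- the block matrix is invertible, and the explicit formula for `∂_θ X⋆(θ)` holds
        (InertialMethod.limitBlock a b γ
          (InertialMethod.hessXX f (xs θ) θ)).IsInvertible ∧
        fderiv ℝ (fun t => (xs t, xs t)) θ =
          (InertialMethod.limitBlock a b γ (InertialMethod.hessXX f (xs θ) θ)).inverse ∘L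
            ((-(γ • InertialMethod.hessXT f (xs θ) θ)).prod 0) := by
  have hLpos : 0 < L := by
    have := (hγ.1.trans hγ.2)
    exact (div_pos_iff_of_pos_left two_pos).1 this
  obtain ⟨τ, hτ, hB⟩ := hB
  have hs : ∀ k, γk k * L / 2 ≤ 1 := fun k => by
    have := (lt_div_iff₀ hLpos).1 (hγk k).2
    linarith
  have hB' : ∀ k, 1 ≤ k → τ ≤ 1 - γk k * L / 2 - ak k - γk k * L / 2 * bk k ^ 2
      - 2 * |ak k - γk k * L / 2 * bk k| := fun k hk =>
    InertialMethod.dissipation_of_alternatives (hbk k).1 (hs k)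
      (hB.imp (fun h => h k hk) fun h => h k hk)
  choose! xs hxs using fun θ (hθ : θ ∈ Θ) =>
    InertialMethod.exists_minimizer hΘ hf hθ (hlev θ hθ)
  choose! μ hμ hsc using hconv
  have hzero : ∀ θ ∈ Θ, InertialMethod.gradX f (xs θ) θ = 0 := fun θ hθ =>
    InertialMethod.gradX_eq_zero_of_minimizer (hxs θ hθ)
  have hLx : ∀ θ ∈ Θ, ∀ x y, ‖InertialMethod.gradX f x θ - InertialMethod.gradX f y θ‖ ≤
      L * ‖x - y‖ := fun θ hθ x y => by
    simpa [Real.sqrt_sq (norm_nonneg _)] using hL x y θ hθ θ hθ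
  have hLθ : ∀ θ ∈ Θ, ∀ t ∈ Θ, ∀ x,
      ‖InertialMethod.gradX f x θ - InertialMethod.gradX f x t‖ ≤ L * ‖t - θ‖ :=
    fun θ hθ t ht x => by
      rw [norm_sub_rev t]
      simpa [Real.sqrt_sq (norm_nonneg _)] using hL x x θ hθ t ht
  have hcoc : ∀ θ ∈ Θ, ∀ x y,
      ‖InertialMethod.gradX f x θ - InertialMethod.gradX f y θ‖ ^ 2 ≤
        L * inner ℝ (x - y) (InertialMethod.gradX f x θ - InertialMethod.gradX f y θ) :=
    fun θ hθ => InertialMethod.norm_gradient_sub_sq_le hLpos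
      (InertialMethod.hasGradientAt_gradX hΘ hf hθ)
      ((hsc θ hθ).strictConvexOn (hμ θ hθ)).convexOn (hLx θ hθ)
  have hmon : ∀ θ ∈ Θ, ∀ x y, μ θ * ‖x - y‖ ^ 2 ≤
      inner ℝ (x - y) (InertialMethod.gradX f x θ - InertialMethod.gradX f y θ) :=
    fun θ hθ => InertialMethod.mul_norm_sub_sq_le_of_strongConvexOn
      (InertialMethod.hasGradientAt_gradX hΘ hf hθ) (hsc θ hθ)
  have hHcoc : ∀ θ ∈ Θ, ∀ x v, ‖InertialMethod.hessXX f x θ v‖ ^ 2 ≤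
      L * inner ℝ v (InertialMethod.hessXX f x θ v) := fun θ hθ x =>
    InertialMethod.norm_fderiv_sq_le_of_cocoercive
      (InertialMethod.hasFDerivAt_gradX_left hΘ hf hθ x) fun y => hcoc θ hθ y x
  have hHmon : ∀ θ ∈ Θ, ∀ x v, μ θ * ‖v‖ ^ 2 ≤
      inner ℝ v (InertialMethod.hessXX f x θ v) := fun θ hθ x =>
    InertialMethod.le_inner_fderiv_of_strongMonotone
      (InertialMethod.hasFDerivAt_gradX_left hΘ hf hθ x) fun y => hmon θ hθ y x
  have hinj : ∀ θ ∈ Θ, Function.Injective (InertialMethod.hessXX f (xs θ) θ) := fun θ hθ =>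
    (injective_iff_map_eq_zero _).2 fun v hv => by
      have h1 := hHmon θ hθ (xs θ) v
      rw [hv, inner_zero_right] at h1
      have h2 : ‖v‖ ^ 2 ≤ 0 := nonpos_of_mul_nonpos_right h1 (hμ θ hθ)
      simpa using le_antisymm h2 (sq_nonneg _)
  have hderiv : ∀ θ ∈ Θ, ∃ D : EuclideanSpace ℝ (Fin m) →L[ℝ] EuclideanSpace ℝ (Fin n),
      HasFDerivAt xs D θ ∧ ∀ v, InertialMethod.hessXX f (xs θ) θ (D v) +
        InertialMethod.hessXT f (xs θ) θ v = 0 := fun θ hθ => by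
    obtain ⟨A, hA⟩ := InertialMethod.exists_equiv_of_injective _ (hinj θ hθ)
    have hev : ∀ᶠ t in 𝓝 θ, t ∈ Θ := hΘ.mem_nhds hθ
    refine ⟨_, InertialMethod.hasFDerivAt_of_implicit (A := A) (C := L / μ θ)
      (InertialMethod.hasFDerivAt_gradX hΘ hf hθ (xs θ)) (by rw [hA]; ext v; simp) ?_ ?_, ?_⟩
    · filter_upwards [hev] with t ht
      exact InertialMethod.norm_minimizer_sub_le (hμ θ hθ) (hmon θ hθ) (hLθ θ hθ t ht _)
        (hzero θ hθ) (hzero t ht)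
    · filter_upwards [hev] with t ht using hzero t ht
    · intro v
      rw [← hA]
      simp
  have hX : ∀ θ ∈ Θ, Tendsto (fun k => InertialMethod.iterate f ak bk γk X₀ k θ) atTop
      (𝓝 (xs θ, xs θ)) := fun θ hθ =>
    InertialMethod.tendsto_iterate hLpos (hμ θ hθ) hτ hγ.1 (fun k => (hγk k).1)
      (fun k => (hak k).1) hbk hB' hak_lim hbk_lim hγk_lim (hcoc θ hθ) (hmon θ hθ) (hzero θ hθ)
  have hderiv2 : ∀ θ ∈ Θ, ∀ D : EuclideanSpace ℝ (Fin m) →L[ℝ] EuclideanSpace ℝ (Fin n),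
      HasFDerivAt xs D θ → HasFDerivAt (fun t => (xs t, xs t)) (D.prod D) θ :=
    fun θ _ D hD => hD.prodMk hD
  refine ⟨xs, fun θ hθ y hy => InertialMethod.lt_of_minimizer (hμ θ hθ) (hsc θ hθ) (hxs θ hθ) hy,
    ⟨fun k θ hθ => InertialMethod.differentiableAt_iterate hΘ hf hθ hX₀ k, fun θ hθ => ?_, hX,
      fun θ hθ => ?_⟩, fun θ hθ => ⟨?_, ?_, ?_, ?_⟩⟩
  · obtain ⟨D, hD, -⟩ := hderiv θ hθ
    exact (hderiv2 θ hθ D hD).differentiableAt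
  · obtain ⟨D, hD, hDeq⟩ := hderiv θ hθ
    rw [(hderiv2 θ hθ D hD).fderiv]
    exact InertialMethod.tendsto_fderiv_iterate hΘ hf hθ hX₀ hLpos (hμ θ hθ) hτ hγ.1
      (fun k => (hγk k).1) (fun k => (hak k).1) hbk hB' hak_lim hbk_lim hγk_lim
      (hHcoc θ hθ) (hHmon θ hθ) (hX θ hθ) hDeq
  · exact InertialMethod.fderiv_stepMap_left hΘ hf hθ a b γ (xs θ)
  · exact InertialMethod.fderiv_stepMap_right hΘ hf hθ a b γ (xs θ)
  · exact InertialMethod.isInvertible_limitBlock a b hγ.1.ne' (hinj θ hθ)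
  · obtain ⟨D, hD, hDeq⟩ := hderiv θ hθ
    rw [(hderiv2 θ hθ D hD).fderiv]
    have hinv := InertialMethod.isInvertible_limitBlock a b hγ.1.ne' (hinj θ hθ)
    obtain ⟨B, hB⟩ := hinv
    rw [← hB, ContinuousLinearMap.inverse_equiv]
    refine ContinuousLinearMap.ext fun v => ?_
    refine (B.symm_apply_eq.2 ?_).symm
    have hBv : B (D v, D v) = InertialMethod.limitBlock a b γ
        (InertialMethod.hessXX f (xs θ) θ) (D v, D v) := by rw [← hB]; rfl
    rw [ContinuousLinearMap.prod_apply, hBv, InertialMethod.limitBlock_apply_diag, eq_neg_of_add_eq_zero_left (hDeq v)]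
    simp
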